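/- Let $\tilde{\mathcal A}$ be the algebra of formal series $\sum_{\nu\ge 0}P_\nu(a)\,b^\nu$, $P_\nu\in\mathbb C[X]$, with $ab-ba=b^2$ and multiplication continuous for the $b$-adic topology. An $(a,b)$-module is a left $\tilde{\mathcal A}$-module that is free of finite type over $\mathbb C[[b]]$; it is regular if it embeds $\tilde{\mathcal A}$-linearly in an $(a,b)$-module $F$ with $aF\subset bF$, and monogenic if it is isomorphic to $\tilde{\mathcal A}/I$ for some left ideal $I$. For $\lambda\in\mathbb C$ put $E_\lambda=\tilde{\mathcal A}/\tilde{\mathcal A}(a-\lambda b)$. Let $E$ be a monogenic regular $(a,b)$-module of rank $k$ over $\mathbb C[[b]]$. A Jordan–Hölder series of $E$ is a chain of $\tilde{\mathcal A}$-submodules $0=F_0\subset F_1\subset\cdots\subset F_k=E$ with $F_j/F_{j-1}\simeq E_{\lambda_j}$ for $1\le j\le k$, where $\lambda_1,\dots,\lambda_k\in\mathbb C$. A Bernstein element of $E$ is an element $P=\sum_{j=0}^k c_j a^jb^{k-j}$ ($c_j\in\mathbb C$, $c_k=1$) such that $E\simeq\tilde{\mathcal A}/\tilde{\mathcal A}(P+b^2R)$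 for some $R\in\tilde{\mathcal A}$ which is a polynomial in $a$ of degree at most $k-1$ with coefficients in $\mathbb C[[b]]$ (so $R=0$ if $k=0$), all of whose monomials $a^ib^\nu$ satisfy $i+\nu\ge k-1$. Suppose that $E$ has a Jordan–Hölder series with quotients $E_{\lambda_1},\dots,E_{\lambda_k}$, in this order. Then: 1. $E$ has exactly one Bernstein element $P_E$, and $$P_E=(a-\lambda_1b)(a-\lambda_2b)\cdots(a-\lambda_kb).$$ 2. If $E$ has another Jordan–Hölder series, with quotients $E_{\mu_1},\dots,E_{\mu_k}$, then $(\mu_1,\dots,\mu_k)$ lies in the orbit of $(\lambda_1,\dots,\lambda_k)$ under the twisted action of $\mathfrak S_k$ on $\mathbb C^k$; that is, there is $\sigma\in\mathfrak S_k$ with $\mu_j=\lambda_{\sigma(j)}+\sigma(j)-j$ for $1\le j\le k$. -/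

import Mathlib

/-- The algebra of formal series `∑_ν P_ν(a) b^ν` with `P_ν ∈ ℂ[X]`, subject to `a b - b a = b²`,
multiplication being continuous for the `b`-adic topology. Such a series is recorded by its
sequence of coefficients `ν ↦ P_ν`. -/
def ABAlgebra : Type := ℕ → Polynomial ℂ

namespace ABAlgebra

noncomputable instance : AddCommGroup ABAlgebra := inferInstanceAs (AddCommGroup (ℕ → Polynomial ℂ))

noncomputable instance : Module ℂ ABAlgebra := inferInstanceAs (Module ℂ (ℕ → Polynomial ℂ))

/-- The series `∑_ν P_ν(a) b^ν`. -/
def mk (P : ℕ → Polynomial ℂ) : ABAlgebra := P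

/-- The coefficient `P_ν` of `b^ν` in `∑_ν P_ν(a) b^ν`. -/
def coeff (P : ABAlgebra) (n : ℕ) : Polynomial ℂ := P n

@[ext] theorem ext {P Q : ABAlgebra} (h : ∀ n, P.coeff n = Q.coeff n) : P = Q := funext h

@[simp] theorem coeff_mk (P : ℕ → Polynomial ℂ) (n : ℕ) : (mk P).coeff n = P n := rfl

@[simp] theorem coeff_add (P Q : ABAlgebra) (n : ℕ) :
    (P + Q).coeff n = P.coeff n + Q.coeff n := rfl

@[simp] theorem coeff_sub (P Q : ABAlgebra) (n : ℕ) :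
    (P - Q).coeff n = P.coeff n - Q.coeff n := rfl

@[simp] theorem coeff_zero (n : ℕ) : (0 : ABAlgebra).coeff n = 0 := rfl

@[simp] theorem coeff_smul (c : ℂ) (P : ABAlgebra) (n : ℕ) :
    (c • P).coeff n = c • P.coeff n := rfl

/-- The binomial coefficient `binom(-m, j)`, so that in the algebra
`b^m f(a) = ∑_j binom(-m, j) f^{(j)}(a) b^{m+j}`. -/
def negBinom (m j : ℕ) : ℤ := (-1) ^ j * (Nat.multichoose m j : ℤ)

/-- The coefficient of `b^{m+r}` in `b^m Q`. -/
noncomputable def bPowMulCoeff (m : ℕ) (Q : ABAlgebra) (r : ℕ) : Polynomial ℂ :=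
  ∑ y ∈ Finset.HasAntidiagonal.antidiagonal r, negBinom m y.2 • Polynomial.derivative^[y.2] (Q.coeff y.1)

noncomputable instance : Mul ABAlgebra where
  mul P Q := mk fun n => ∑ x ∈ Finset.HasAntidiagonal.antidiagonal n, P.coeff x.1 * bPowMulCoeff x.1 Q x.2

noncomputable instance : One ABAlgebra where
  one := mk fun n => if n = 0 then 1 else 0

theorem coeff_mul (P Q : ABAlgebra) (n : ℕ) :
    (P * Q).coeff n = ∑ x ∈ Finset.HasAntidiagonal.antidiagonal n, P.coeff x.1 * bPowMulCoeff x.1 Q x.2 := rfl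

theorem coeff_one (n : ℕ) : (1 : ABAlgebra).coeff n = if n = 0 then 1 else 0 := rfl

/-- The element `f(a)`. -/
noncomputable def ofPoly (f : Polynomial ℂ) : ABAlgebra := mk fun n => if n = 0 then f else 0

theorem coeff_ofPoly (f : Polynomial ℂ) (n : ℕ) :
    (ofPoly f).coeff n = if n = 0 then f else 0 := rfl

/-- The generator `a`. -/
noncomputable def a : ABAlgebra := ofPoly Polynomial.X

/-- The generator `b`. -/
noncomputable def b : ABAlgebra := mk fun n => if n = 1 then 1 else 0

theorem coeff_b (n : ℕ) : b.coeff n = if n = 1 then 1 else 0 := rfl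

/-- Right multiplication by `b`. -/
noncomputable def shiftB (P : ABAlgebra) : ABAlgebra := mk fun n => Nat.casesOn n 0 fun k => P.coeff k

/-- Right multiplication by `a`. -/
noncomputable def shiftA (P : ABAlgebra) : ABAlgebra := mk fun n =>
  Polynomial.X * P.coeff n - Nat.casesOn n 0 fun k => (k : ℤ) • P.coeff k

@[simp] theorem coeff_shiftB_zero (P : ABAlgebra) : (shiftB P).coeff 0 = 0 := rfl

@[simp] theorem coeff_shiftB_succ (P : ABAlgebra) (n : ℕ) :
    (shiftB P).coeff (n + 1) = P.coeff n := rfl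

theorem coeff_shiftA_zero (P : ABAlgebra) : (shiftA P).coeff 0 = Polynomial.X * P.coeff 0 :=
  sub_zero _

theorem coeff_shiftA_succ (P : ABAlgebra) (n : ℕ) :
    (shiftA P).coeff (n + 1) = Polynomial.X * P.coeff (n + 1) - (n : ℤ) • P.coeff n := rfl

theorem negBinom_succ (m j : ℕ) :
    ((j : ℤ) + 1) * negBinom m (j + 1) = -((m : ℤ) + j) * negBinom m j := by
  have h : (j + 1) * Nat.multichoose m (j + 1) = (m + j) * Nat.multichoose m j := by
    cases m with
    | zero => cases j <;> simp
    | succ m =>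
      rw [Nat.multichoose_eq, Nat.multichoose_eq]
      have h1 := Nat.add_one_mul_choose_eq (m + j) j
      have e1 : m + 1 + (j + 1) - 1 = m + j + 1 := by omega
      have e2 : m + 1 + j - 1 = m + j := by omega
      rw [e1, e2]
      linarith
  have h' : ((j : ℤ) + 1) * (Nat.multichoose m (j + 1) : ℤ)
      = ((m : ℤ) + j) * (Nat.multichoose m j : ℤ) := by exact_mod_cast h
  unfold negBinom
  rw [pow_succ]
  linear_combination (-(-1 : ℤ) ^ j) * h'

theorem bPowMulCoeff_shiftB_zero (m : ℕ) (Q : ABAlgebra) : bPowMulCoeff m (shiftB Q) 0 = 0 := by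
  simp [bPowMulCoeff]

theorem bPowMulCoeff_shiftB_succ (m : ℕ) (Q : ABAlgebra) (r : ℕ) :
    bPowMulCoeff m (shiftB Q) (r + 1) = bPowMulCoeff m Q r := by
  unfold bPowMulCoeff
  rw [Finset.Nat.sum_antidiagonal_succ]
  simp

theorem mul_shiftB (P Q : ABAlgebra) : P * shiftB Q = shiftB (P * Q) := by
  ext1 n
  cases n with
  | zero => simp [coeff_mul, bPowMulCoeff_shiftB_zero]
  | succ n =>
    rw [coeff_mul, Finset.Nat.sum_antidiagonal_succ', coeff_shiftB_succ, coeff_mul]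
    simp [bPowMulCoeff_shiftB_zero, bPowMulCoeff_shiftB_succ]

theorem bPowMulCoeff_shiftA_zero (m : ℕ) (Q : ABAlgebra) :
    bPowMulCoeff m (shiftA Q) 0 = Polynomial.X * bPowMulCoeff m Q 0 := by
  simp [bPowMulCoeff, coeff_shiftA_zero]
  ring

theorem iterate_derivative_X_mul' (j : ℕ) (f : Polynomial ℂ) :
    Polynomial.derivative^[j + 1] (Polynomial.X * f)
      = Polynomial.X * Polynomial.derivative^[j + 1] f
        + ((j : ℤ) + 1) • Polynomial.derivative^[j] f := by
  have := Polynomial.iterate_derivative_mul_X (n := j + 1) f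
  rw [mul_comm, this]
  simp [add_smul, mul_comm]

theorem bPowMulCoeff_shiftA_succ (m : ℕ) (Q : ABAlgebra) (r : ℕ) :
    bPowMulCoeff m (shiftA Q) (r + 1)
      = Polynomial.X * bPowMulCoeff m Q (r + 1) - ((m : ℤ) + r) • bPowMulCoeff m Q r := by
  have key : bPowMulCoeff m (shiftA Q) (r + 1) - Polynomial.X * bPowMulCoeff m Q (r + 1)
      = ∑ y ∈ Finset.HasAntidiagonal.antidiagonal r,
          (negBinom m (y.2 + 1) * ((y.2 : ℤ) + 1)) • Polynomial.derivative^[y.2] (Q.coeff y.1)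
        - ∑ y ∈ Finset.HasAntidiagonal.antidiagonal r,
          (negBinom m y.2 * (y.1 : ℤ)) • Polynomial.derivative^[y.2] (Q.coeff y.1) := by
    have h1 : ∑ y ∈ Finset.HasAntidiagonal.antidiagonal r,
          (negBinom m (y.2 + 1) * ((y.2 : ℤ) + 1)) • Polynomial.derivative^[y.2] (Q.coeff y.1)
        = ∑ y ∈ Finset.HasAntidiagonal.antidiagonal (r + 1), negBinom m y.2 •
          (Polynomial.derivative^[y.2] (Polynomial.X * Q.coeff y.1)
            - Polynomial.X * Polynomial.derivative^[y.2] (Q.coeff y.1)) := by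
      rw [Finset.Nat.sum_antidiagonal_succ']
      simp only [Function.iterate_zero, id, sub_self, smul_zero, zero_add,
        iterate_derivative_X_mul', add_sub_cancel_left, smul_smul]
    have h2 : ∑ y ∈ Finset.HasAntidiagonal.antidiagonal r,
          (negBinom m y.2 * (y.1 : ℤ)) • Polynomial.derivative^[y.2] (Q.coeff y.1)
        = ∑ y ∈ Finset.HasAntidiagonal.antidiagonal (r + 1), negBinom m y.2 •
          (Polynomial.derivative^[y.2] (Polynomial.X * Q.coeff y.1)
            - Polynomial.derivative^[y.2] ((shiftA Q).coeff y.1)) := by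
      rw [Finset.Nat.sum_antidiagonal_succ]
      simp only [coeff_shiftA_zero, coeff_shiftA_succ, sub_self, smul_zero, zero_add,
        Polynomial.iterate_derivative_sub, sub_sub_cancel, Polynomial.iterate_derivative_smul,
        smul_smul]
    rw [h1, h2, ← Finset.sum_sub_distrib]
    unfold bPowMulCoeff
    rw [Finset.mul_sum, ← Finset.sum_sub_distrib]
    refine Finset.sum_congr rfl fun y _ => ?_
    rw [mul_smul_comm, ← smul_sub, ← smul_sub]
    congr 1
    ring
  have h3 : ∑ y ∈ Finset.HasAntidiagonal.antidiagonal r,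
          (negBinom m (y.2 + 1) * ((y.2 : ℤ) + 1)) • Polynomial.derivative^[y.2] (Q.coeff y.1)
        - ∑ y ∈ Finset.HasAntidiagonal.antidiagonal r,
          (negBinom m y.2 * (y.1 : ℤ)) • Polynomial.derivative^[y.2] (Q.coeff y.1)
      = -(((m : ℤ) + r) • bPowMulCoeff m Q r) := by
    unfold bPowMulCoeff
    rw [← Finset.sum_sub_distrib, Finset.smul_sum, ← Finset.sum_neg_distrib]
    refine Finset.sum_congr rfl fun y hy => ?_
    rw [Finset.HasAntidiagonal.mem_antidiagonal] at hy
    rw [← sub_smul, smul_smul, ← neg_smul]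
    congr 1
    have := negBinom_succ m y.2
    rw [← hy]
    push_cast
    linear_combination this
  rw [sub_eq_iff_eq_add'.mp (key.trans h3)]
  ring

theorem mul_shiftA (P Q : ABAlgebra) : P * shiftA Q = shiftA (P * Q) := by
  ext1 n
  cases n with
  | zero =>
    simp only [coeff_mul, coeff_shiftA_zero, Finset.Nat.antidiagonal_zero, Finset.sum_singleton,
      bPowMulCoeff_shiftA_zero]
    ring
  | succ n =>
    rw [coeff_mul, coeff_shiftA_succ, coeff_mul, coeff_mul, Finset.Nat.sum_antidiagonal_succ',
      Finset.Nat.sum_antidiagonal_succ', mul_add, Finset.mul_sum, Finset.smul_sum, add_sub_assoc,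
      ← Finset.sum_sub_distrib]
    congr 1
    · rw [bPowMulCoeff_shiftA_zero]
      ring
    · refine Finset.sum_congr rfl fun x hx => ?_
      rw [Finset.HasAntidiagonal.mem_antidiagonal] at hx
      rw [bPowMulCoeff_shiftA_succ, ← hx]
      simp only [zsmul_eq_mul]
      push_cast
      ring

theorem bPowMulCoeff_add (m : ℕ) (Q R : ABAlgebra) (r : ℕ) :
    bPowMulCoeff m (Q + R) r = bPowMulCoeff m Q r + bPowMulCoeff m R r := by
  simp [bPowMulCoeff, iterate_map_add, Finset.sum_add_distrib]

theorem bPowMulCoeff_smul (m : ℕ) (c : ℂ) (Q : ABAlgebra) (r : ℕ) :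
    bPowMulCoeff m (c • Q) r = c • bPowMulCoeff m Q r := by
  simp [bPowMulCoeff, Polynomial.iterate_derivative_smul, Finset.smul_sum]

theorem bPowMulCoeff_one (m r : ℕ) : bPowMulCoeff m 1 r = if r = 0 then 1 else 0 := by
  unfold bPowMulCoeff
  cases r with
  | zero => simp [coeff_one, negBinom]
  | succ r =>
    rw [Finset.Nat.sum_antidiagonal_succ]
    simp [coeff_one]

theorem bPowMulCoeff_zero_left (Q : ABAlgebra) (r : ℕ) : bPowMulCoeff 0 Q r = Q.coeff r := by
  unfold bPowMulCoeff
  cases r with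
  | zero => simp [negBinom]
  | succ r =>
    rw [Finset.Nat.sum_antidiagonal_succ']
    simp [negBinom]

protected theorem mul_add' (P Q R : ABAlgebra) : P * (Q + R) = P * Q + P * R := by
  ext1 n
  simp [coeff_mul, bPowMulCoeff_add, mul_add, Finset.sum_add_distrib]

protected theorem add_mul' (P Q R : ABAlgebra) : (P + Q) * R = P * R + Q * R := by
  ext1 n
  simp [coeff_mul, add_mul, Finset.sum_add_distrib]

protected theorem mul_smul' (c : ℂ) (P Q : ABAlgebra) : P * (c • Q) = c • (P * Q) := by
  ext1 n
  simp [coeff_mul, bPowMulCoeff_smul, Finset.smul_sum]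

protected theorem smul_mul' (c : ℂ) (P Q : ABAlgebra) : (c • P) * Q = c • (P * Q) := by
  ext1 n
  simp [coeff_mul, Finset.smul_sum]

theorem ofPoly_mul (f : Polynomial ℂ) (Q : ABAlgebra) (n : ℕ) :
    (ofPoly f * Q).coeff n = f * Q.coeff n := by
  rw [coeff_mul]
  cases n with
  | zero => simp [coeff_ofPoly, bPowMulCoeff_zero_left]
  | succ n =>
    rw [Finset.Nat.sum_antidiagonal_succ]
    simp [coeff_ofPoly, bPowMulCoeff_zero_left]

protected theorem one_mul' (Q : ABAlgebra) : 1 * Q = Q := by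
  have h : (1 : ABAlgebra) = ofPoly 1 := rfl
  ext1 n
  rw [h, ofPoly_mul, one_mul]

protected theorem mul_one' (P : ABAlgebra) : P * 1 = P := by
  ext1 n
  rw [coeff_mul]
  cases n with
  | zero => simp [bPowMulCoeff_one]
  | succ n =>
    rw [Finset.Nat.sum_antidiagonal_succ']
    simp [bPowMulCoeff_one]

/-- A linear map that commutes with both right multiplications and kills `1` is zero. -/
theorem eq_zero_of_commutes (χ : ABAlgebra →ₗ[ℂ] ABAlgebra)
    (hA : ∀ P, χ (shiftA P) = shiftA (χ P)) (hB : ∀ P, χ (shiftB P) = shiftB (χ P))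
    (h1 : χ 1 = 0) (P : ABAlgebra) : χ P = 0 := by
  have sA0 : shiftA (0 : ABAlgebra) = 0 := by
    ext1 n
    cases n <;> simp [coeff_shiftA_zero, coeff_shiftA_succ]
  have hpoly : ∀ f : Polynomial ℂ, χ (ofPoly f) = 0 := by
    intro f
    induction f using Polynomial.induction_on with
    | C c =>
      have : ofPoly (Polynomial.C c) = c • (1 : ABAlgebra) := by
        ext1 n
        rw [coeff_ofPoly, coeff_smul, coeff_one]
        split_ifs <;> simp [Polynomial.smul_eq_C_mul]
      rw [this, map_smul, h1, smul_zero]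
    | add p q hp hq =>
      have : ofPoly (p + q) = ofPoly p + ofPoly q := by
        ext1 n
        rw [coeff_add, coeff_ofPoly, coeff_ofPoly, coeff_ofPoly]
        split_ifs <;> simp
      rw [this, map_add, hp, hq, add_zero]
    | monomial n c h =>
      have : ofPoly (Polynomial.C c * Polynomial.X ^ (n + 1))
          = shiftA (ofPoly (Polynomial.C c * Polynomial.X ^ n)) := by
        ext1 k
        cases k with
        | zero =>
          rw [coeff_shiftA_zero, coeff_ofPoly, coeff_ofPoly]
          simp only [if_true]
          ring
        | succ k =>
          rw [coeff_shiftA_succ, coeff_ofPoly, coeff_ofPoly, coeff_ofPoly]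
          cases k <;> simp
      rw [this, hA, h, sA0]
  have key : ∀ n : ℕ, ∀ Q : ABAlgebra, (χ Q).coeff n = 0 := by
    intro n
    have split : ∀ Q : ABAlgebra,
        Q = ofPoly (Q.coeff 0) + shiftB (mk fun k => Q.coeff (k + 1)) := by
      intro Q
      ext1 k
      cases k with
      | zero => simp [coeff_ofPoly]
      | succ k =>
        rw [coeff_add, coeff_shiftB_succ, coeff_ofPoly, if_neg (Nat.succ_ne_zero k), zero_add,
          coeff_mk]
    induction n with
    | zero =>
      intro Q
      rw [split Q, map_add, hpoly, hB, zero_add, coeff_shiftB_zero]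
    | succ n ih =>
      intro Q
      rw [split Q, map_add, hpoly, hB, zero_add, coeff_shiftB_succ, ih]
  ext1 n
  exact key n P

/-- Left multiplication as a linear map. -/
noncomputable def leftMul (P : ABAlgebra) : ABAlgebra →ₗ[ℂ] ABAlgebra where
  toFun Q := P * Q
  map_add' := ABAlgebra.mul_add' P
  map_smul' c Q := ABAlgebra.mul_smul' c P Q

protected theorem mul_assoc' (P Q R : ABAlgebra) : P * Q * R = P * (Q * R) := by
  have shA : ∀ U V : ABAlgebra, shiftA (U - V) = shiftA U - shiftA V := by
    intro U V
    ext1 n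
    cases n with
    | zero => simp [coeff_shiftA_zero, mul_sub]
    | succ n =>
      simp only [coeff_shiftA_succ, coeff_sub, mul_sub, smul_sub]
      ring
  have shB : ∀ U V : ABAlgebra, shiftB (U - V) = shiftB U - shiftB V := by
    intro U V
    ext1 n
    cases n <;> simp
  have h := eq_zero_of_commutes (leftMul (P * Q) - leftMul P ∘ₗ leftMul Q)
    (fun W => by simp [leftMul, mul_shiftA, shA]) (fun W => by simp [leftMul, mul_shiftB, shB])
    (by simp [leftMul, ABAlgebra.mul_one']) R
  exact sub_eq_zero.mp h

noncomputable instance : Ring ABAlgebra :=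
  { (inferInstance : AddCommGroup ABAlgebra), (inferInstance : Mul ABAlgebra),
    (inferInstance : One ABAlgebra) with
    left_distrib := ABAlgebra.mul_add'
    right_distrib := ABAlgebra.add_mul'
    zero_mul := fun P => by ext1 n; simp [coeff_mul]
    mul_zero := fun P => (leftMul P).map_zero
    mul_assoc := ABAlgebra.mul_assoc'
    one_mul := ABAlgebra.one_mul'
    mul_one := ABAlgebra.mul_one' }

noncomputable instance : Algebra ℂ ABAlgebra :=
  Algebra.ofModule ABAlgebra.smul_mul' ABAlgebra.mul_smul'

theorem mul_b (P : ABAlgebra) : P * b = shiftB P := by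
  have h : b = shiftB 1 := by
    ext1 n
    cases n with
    | zero => simp [coeff_b]
    | succ n => simp [coeff_b, coeff_one]
  rw [h, mul_shiftB, mul_one]

theorem mul_a (P : ABAlgebra) : P * a = shiftA P := by
  have h : a = shiftA 1 := by
    ext1 n
    unfold a
    cases n with
    | zero => simp [coeff_ofPoly, coeff_shiftA_zero, coeff_one]
    | succ n => cases n <;> simp [coeff_ofPoly, coeff_shiftA_succ, coeff_one]
  rw [h, mul_shiftA, mul_one]

/-- The defining commutation relation. -/
theorem a_mul_b_sub_b_mul_a : a * b - b * a = b ^ 2 := by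
  rw [pow_two, mul_b, mul_a, mul_b]
  ext1 n
  unfold a
  match n with
  | 0 => simp [coeff_shiftA_zero, coeff_b]
  | 1 => simp [coeff_shiftA_succ, coeff_b, coeff_ofPoly]
  | 2 => simp [coeff_shiftA_succ, coeff_b, coeff_ofPoly]
  | n + 3 => simp [coeff_shiftA_succ, coeff_b, coeff_ofPoly]

/-- The sequence of coefficients of `f(a) b^m` is `f` in position `m`. -/
theorem coeff_ofPoly_mul_b_pow (f : Polynomial ℂ) (m n : ℕ) :
    (ofPoly f * b ^ m).coeff n = if n = m then f else 0 := by
  induction m generalizing n with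
  | zero => simp [coeff_ofPoly]
  | succ m ih =>
    rw [pow_succ, ← mul_assoc, mul_b]
    cases n with
    | zero => simp
    | succ n => simp [ih]

/-- The inclusion `ℂ[[b]] ⊆ ABAlgebra`, sending `∑ s_ν b^ν` to the series with constant
coefficients `s_ν`. -/
noncomputable def ofPowerSeries : PowerSeries ℂ →+* ABAlgebra where
  toFun S := mk fun n => Polynomial.C (PowerSeries.coeff n S)
  map_one' := by
    ext1 n
    rw [coeff_mk, PowerSeries.coeff_one, coeff_one]
    split_ifs <;> simp
  map_zero' := by
    ext1 n
    simp
  map_add' S T := by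
    ext1 n
    simp
  map_mul' S T := by
    have h : ∀ (m r : ℕ) (U : PowerSeries ℂ),
        bPowMulCoeff m (mk fun n => Polynomial.C (PowerSeries.coeff n U)) r
          = Polynomial.C (PowerSeries.coeff r U) := by
      intro m r U
      unfold bPowMulCoeff
      cases r with
      | zero => simp [negBinom]
      | succ r =>
        rw [Finset.Nat.sum_antidiagonal_succ']
        simp [negBinom]
    ext1 n
    rw [coeff_mul]
    simp only [h, coeff_mk]
    rw [PowerSeries.coeff_mul, map_sum]
    simp

/-- `P` is homogeneous of degree `k` in `(a, b)` and monic in `a`: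
`P = ∑_{j=0}^k c_j a^j b^{k-j}` with `c_k = 1`. -/
def IsMonicHomogeneous (k : ℕ) (P : ABAlgebra) : Prop :=
  ∃ c : ℕ → ℂ, c k = 1 ∧ P = ∑ j ∈ Finset.range (k + 1), c j • (a ^ j * b ^ (k - j))

/-- `R` is a polynomial in `a`, with coefficients in `ℂ[[b]]`, of degree `< k`. -/
def DegreeLT (k : ℕ) (R : ABAlgebra) : Prop := ∀ ν, (R.coeff ν).degree < (k : WithBot ℕ)

/-- The valuation of `R` in `(a, b)` is at least `d`: every monomial `a^i b^ν` that occurs in `R`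
has `d ≤ i + ν`. -/
def ValuationGE (d : ℤ) (R : ABAlgebra) : Prop :=
  ∀ ν i : ℕ, (R.coeff ν).coeff i ≠ 0 → d ≤ (i : ℤ) + ν

/-- The left ideal generated by `x`. -/
noncomputable def leftIdeal (x : ABAlgebra) : Submodule ABAlgebra ABAlgebra := Submodule.span ABAlgebra {x}

/-- The module `E_λ`, the quotient of the algebra by the left ideal generated by `a - λ b`. -/
abbrev ELambda (l : ℂ) : Type := ABAlgebra ⧸ leftIdeal (a - l • b)

section Modules

universe u

/-- The `ℂ[[b]]`-module structure underlying a left module over the algebra. -/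
noncomputable abbrev powerSeriesModule (E : Type u) [AddCommGroup E] [Module ABAlgebra E] :
    Module (PowerSeries ℂ) E := Module.compHom E ofPowerSeries

/-- An (a,b)-module: a left module over the algebra which is free of finite type over `ℂ[[b]]`. -/
def IsABModule (E : Type u) [AddCommGroup E] [Module ABAlgebra E] : Prop :=
  letI := powerSeriesModule E
  Module.Free (PowerSeries ℂ) E ∧ Module.Finite (PowerSeries ℂ) E

/-- The rank over `ℂ[[b]]`. -/
noncomputable def rank (E : Type u) [AddCommGroup E] [Module ABAlgebra E] : ℕ :=
  letI := powerSeriesModule E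
  Module.finrank (PowerSeries ℂ) E

/-- A simple pole (a,b)-module: `a F ⊆ b F`. -/
def HasSimplePole (F : Type u) [AddCommGroup F] [Module ABAlgebra F] : Prop :=
  IsABModule F ∧ ∀ x : F, ∃ y : F, a • x = b • y

/-- A regular (a,b)-module: an (a,b)-module that embeds in a simple pole (a,b)-module. -/
def IsRegular (E : Type u) [AddCommGroup E] [Module ABAlgebra E] : Prop :=
  IsABModule E ∧ ∃ (F : Type u) (_ : AddCommGroup F) (_ : Module ABAlgebra F),
    HasSimplePole F ∧ ∃ f : E →ₗ[ABAlgebra] F, Function.Injective f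

/-- A monogenic module: isomorphic to the quotient of the algebra by a left ideal. -/
def IsMonogenic (E : Type u) [AddCommGroup E] [Module ABAlgebra E] : Prop :=
  ∃ I : Submodule ABAlgebra ABAlgebra, Nonempty (E ≃ₗ[ABAlgebra] (ABAlgebra ⧸ I))

/-- `P` is a Bernstein element of the monogenic module `E` of rank `k`: it is homogeneous of degree
`k` in `(a, b)`, monic in `a`, and `E` is isomorphic to the quotient by a left ideal generated by an
element `P + b² R`, where `R` is a polynomial in `a` of degree at most `k - 1` with coefficients in
`ℂ[[b]]` and with valuation in `(a, b)` at least `k - 1`. -/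
def IsBernsteinElement (E : Type u) [AddCommGroup E] [Module ABAlgebra E] (P : ABAlgebra) : Prop :=
  IsMonicHomogeneous (rank E) P ∧ ∃ R : ABAlgebra,
    DegreeLT (rank E) R ∧ ValuationGE ((rank E : ℤ) - 1) R ∧
      Nonempty (E ≃ₗ[ABAlgebra] (ABAlgebra ⧸ leftIdeal (P + b ^ 2 * R)))

/-- `0 = F_0 ⊆ F_1 ⊆ ⋯ ⊆ F_k = E` is a Jordan-Hölder series of `E` with quotients
`F_j / F_{j-1} ≃ E_{λ_j}`, where `λ_j` is `l (j - 1)`. -/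
structure IsJordanHolder {E : Type u} [AddCommGroup E] [Module ABAlgebra E] {k : ℕ}
    (F : Fin (k + 1) → Submodule ABAlgebra E) (l : Fin k → ℂ) : Prop where
  bot : F 0 = ⊥
  top : F (Fin.last k) = ⊤
  mono : Monotone F
  quot : ∀ j : Fin k, Nonempty
    ((F j.succ ⧸ (F j.castSucc).submoduleOf (F j.succ)) ≃ₗ[ABAlgebra] ELambda (l j))

end Modules

/-- The twisted action of the symmetric group on `ℂ^k`: the `j`-th entry of the image of `l` under
`σ` is `l_{σ(j)} + σ(j) - j`. -/
def twist {k : ℕ} (σ : Equiv.Perm (Fin k)) (l : Fin k → ℂ) : Fin k → ℂ :=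
  fun j => l (σ j) + ((σ j : ℕ) : ℂ) - ((j : ℕ) : ℂ)

theorem twist_one {k : ℕ} (l : Fin k → ℂ) : twist 1 l = l := by
  funext j
  simp [twist]

theorem twist_mul {k : ℕ} (σ τ : Equiv.Perm (Fin k)) (l : Fin k → ℂ) :
    twist (σ * τ) l = twist τ (twist σ l) := by
  funext j
  simp only [twist, Equiv.Perm.mul_apply]
  ring

/-- The orbit of `l` under the twisted action. -/
def twistedOrbit {k : ℕ} (l : Fin k → ℂ) : Set (Fin k → ℂ) :=
  Set.range fun σ : Equiv.Perm (Fin k) => twist σ l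

/-- The ordered product `(a - λ_1 b) (a - λ_2 b) ⋯ (a - λ_k b)`. -/
noncomputable def linearProduct {k : ℕ} (l : Fin k → ℂ) : ABAlgebra :=
  (List.ofFn fun j => a - l j • b).prod

end ABAlgebra

namespace ABAlgebra

/-! The relation `ab - ba = b²` is homogeneous, so total degree in `(a, b)` grades monomials, and
the initial form (the part of least total degree) of an element can be followed through products.

Existence: climb the Jordan–Hölder series. A generator of `F_{j+1}` maps to a unit of `ℂ[[b]]` times
the canonical generator of `E_λ`, where `λ` is the next exponent. After correcting by that unit, `(a
- λb)e` generates `F_j`, so the annihilator picks up `a - λb` as a right factor. Hence a generator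
of `E` has annihilator `ÃP`, with the initial form of `P` a nonzero multiple of the ordered product
of the `a - λ_j b` (`IsJordanHolder.exists_annihilator`). A unit of `ℂ[[b]]` brings `P` to the shape
required of a Bernstein element (`HasInitialForm.exists_mul_eq`).

Uniqueness: two presentations of `E` differ by `e' = u e`. Comparing terms of least degree shows
that the two Bernstein elements are proportional, and both are monic (`IsBernsteinElement.unique`).

Orbits: two series thus give the same product. In `E_z` that product sends the generator to a
multiple of `b^k` whose coefficient is a polynomial in `z`. Its roots determine the multiset of the
`λ_j + j`, which is a complete invariant of the twisted orbit
(`mem_twistedOrbit_of_linearProduct_eq`). -/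

/-! ### Total degree in `a` and `b` -/

theorem coeff_zero_mul (P Q : ABAlgebra) : (P * Q).coeff 0 = P.coeff 0 * Q.coeff 0 := by
  simp [coeff_mul, bPowMulCoeff, negBinom]

/-- A monomial of a product comes from monomials of the factors whose total degrees add up. -/
theorem exists_coeff_ne_zero_of_mul {P Q : ABAlgebra} {n i : ℕ}
    (h : ((P * Q).coeff n).coeff i ≠ 0) :
    ∃ ν₁ i₁ ν₂ i₂ : ℕ, (P.coeff ν₁).coeff i₁ ≠ 0 ∧ (Q.coeff ν₂).coeff i₂ ≠ 0 ∧
      i₁ + ν₁ + (i₂ + ν₂) = i + n := by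
  rw [coeff_mul, Polynomial.finsetSum_coeff] at h
  obtain ⟨x, hx, hx0⟩ := Finset.exists_ne_zero_of_sum_ne_zero h
  rw [Polynomial.coeff_mul] at hx0
  obtain ⟨z, hz, hz0⟩ := Finset.exists_ne_zero_of_sum_ne_zero hx0
  have hz1 := right_ne_zero_of_mul hz0
  rw [bPowMulCoeff, Polynomial.finsetSum_coeff] at hz1
  obtain ⟨y, hy, hy0⟩ := Finset.exists_ne_zero_of_sum_ne_zero hz1
  rw [Polynomial.coeff_smul, Polynomial.coeff_iterate_derivative] at hy0
  rw [Finset.HasAntidiagonal.mem_antidiagonal] at hx hz hy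
  refine ⟨x.1, z.1, y.1, z.2 + y.2, left_ne_zero_of_mul hz0, fun h0 => hy0 ?_, by omega⟩
  rw [h0, smul_zero, smul_zero]

/-- All monomials of `P` have total degree `d`. -/
def IsHomogeneous (d : ℕ) (P : ABAlgebra) : Prop :=
  ∀ ν i : ℕ, (P.coeff ν).coeff i ≠ 0 → i + ν = d

theorem IsHomogeneous.mul {P Q : ABAlgebra} {d e : ℕ} (hP : IsHomogeneous d P)
    (hQ : IsHomogeneous e Q) : IsHomogeneous (d + e) (P * Q) := by
  intro n i h
  obtain ⟨ν₁, i₁, ν₂, i₂, h₁, h₂, h₃⟩ := exists_coeff_ne_zero_of_mul h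
  have := hP _ _ h₁
  have := hQ _ _ h₂
  omega

theorem ValuationGE.mul {P Q : ABAlgebra} {d e : ℤ} (hP : ValuationGE d P)
    (hQ : ValuationGE e Q) : ValuationGE (d + e) (P * Q) := by
  intro n i h
  obtain ⟨ν₁, i₁, ν₂, i₂, h₁, h₂, h₃⟩ := exists_coeff_ne_zero_of_mul h
  have := hP _ _ h₁
  have := hQ _ _ h₂
  omega

theorem ValuationGE.add {P Q : ABAlgebra} {d : ℤ} (hP : ValuationGE d P)
    (hQ : ValuationGE d Q) : ValuationGE d (P + Q) := by
  intro n i h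
  by_cases h0 : (P.coeff n).coeff i = 0
  · refine hQ n i fun h1 => h ?_
    rw [coeff_add, Polynomial.coeff_add, h0, h1, add_zero]
  · exact hP n i h0

theorem ValuationGE.smul {P : ABAlgebra} {d : ℤ} (c : ℂ) (hP : ValuationGE d P) :
    ValuationGE d (c • P) := by
  intro n i h
  refine hP n i fun h0 => h ?_
  rw [coeff_smul, Polynomial.coeff_smul, h0, smul_zero]

theorem ValuationGE.sub {P Q : ABAlgebra} {d : ℤ} (hP : ValuationGE d P)
    (hQ : ValuationGE d Q) : ValuationGE d (P - Q) := by
  have h := hP.add (hQ.smul (-1))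
  rwa [neg_one_smul, ← sub_eq_add_neg] at h

theorem valuationGE_zero (P : ABAlgebra) : ValuationGE 0 P := fun _ _ _ => by omega

theorem IsHomogeneous.valuationGE {P : ABAlgebra} {d : ℕ} (hP : IsHomogeneous d P) :
    ValuationGE d P := fun ν i h => by
  have := hP ν i h
  omega

theorem IsHomogeneous.sub_smul {P Q : ABAlgebra} {d : ℕ} (c : ℂ) (hP : IsHomogeneous d P)
    (hQ : IsHomogeneous d Q) : IsHomogeneous d (P - c • Q) := by
  intro n i h
  by_cases h0 : (P.coeff n).coeff i = 0
  · refine hQ n i fun h1 => h ?_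
    rw [coeff_sub, Polynomial.coeff_sub, coeff_smul, Polynomial.coeff_smul, h0, h1, smul_zero,
      sub_zero]
  · exact hP n i h0

/-- A homogeneous element of degree `d` and valuation greater than `d` is zero. -/
theorem IsHomogeneous.eq_zero {P : ABAlgebra} {d : ℕ} (hP : IsHomogeneous d P)
    (hV : ValuationGE (d + 1) P) : P = 0 := by
  ext1 n
  ext i
  rw [coeff_zero, Polynomial.coeff_zero]
  by_contra h
  have := hP n i h
  have := hV n i h
  omega

theorem isHomogeneous_one : IsHomogeneous 0 1 := by
  intro n i h
  rw [coeff_one] at h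
  split_ifs at h with hn
  · rw [Polynomial.coeff_one] at h
    split_ifs at h with hi
    · omega
    · exact absurd rfl h
  · simp at h

theorem isHomogeneous_a : IsHomogeneous 1 a := by
  intro n i h
  rw [a, coeff_ofPoly] at h
  split_ifs at h with hn
  · rw [Polynomial.coeff_X] at h
    split_ifs at h with hi
    · omega
    · exact absurd rfl h
  · simp at h

theorem isHomogeneous_b : IsHomogeneous 1 b := by
  intro n i h
  rw [coeff_b] at h
  split_ifs at h with hn
  · rw [Polynomial.coeff_one] at h
    split_ifs at h with hi
    · omega
    · exact absurd rfl h
  · simp at h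

theorem isHomogeneous_a_sub_smul_b (c : ℂ) : IsHomogeneous 1 (a - c • b) :=
  isHomogeneous_a.sub_smul c isHomogeneous_b

theorem coeff_zero_a_sub_smul_b (c : ℂ) : (a - c • b).coeff 0 = Polynomial.X := by
  simp [a, coeff_ofPoly, coeff_b]

/-! ### Products of linear factors and monic homogeneous elements -/

theorem linearProduct_zero (l : Fin 0 → ℂ) : linearProduct l = 1 := by
  simp [linearProduct]

theorem linearProduct_succ {k : ℕ} (l : Fin (k + 1) → ℂ) :
    linearProduct l = (a - l 0 • b) * linearProduct (fun j => l j.succ) := by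
  simp [linearProduct, List.ofFn_succ]

theorem linearProduct_succ_last {k : ℕ} (l : Fin (k + 1) → ℂ) :
    linearProduct l = linearProduct (fun j => l j.castSucc) * (a - l (Fin.last k) • b) := by
  rw [linearProduct, List.ofFn_succ']
  simp [linearProduct]

theorem isHomogeneous_linearProduct {k : ℕ} (l : Fin k → ℂ) :
    IsHomogeneous k (linearProduct l) := by
  induction k with
  | zero => simpa [linearProduct_zero] using isHomogeneous_one
  | succ k ih =>
    rw [linearProduct_succ_last]
    exact (ih _).mul (isHomogeneous_a_sub_smul_b _)

theorem coeff_zero_linearProduct {k : ℕ} (l : Fin k → ℂ) :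
    (linearProduct l).coeff 0 = Polynomial.X ^ k := by
  induction k with
  | zero => simp [linearProduct_zero, coeff_one]
  | succ k ih =>
    rw [linearProduct_succ_last, coeff_zero_mul, ih, coeff_zero_a_sub_smul_b, pow_succ]

theorem a_pow_eq_ofPoly (j : ℕ) : a ^ j = ofPoly (Polynomial.X ^ j) := by
  induction j with
  | zero => rfl
  | succ j ih =>
    ext1 n
    rw [pow_succ', ih, a, ofPoly_mul, coeff_ofPoly, coeff_ofPoly, pow_succ']
    split_ifs <;> simp

theorem coeff_sum {ι : Type*} (s : Finset ι) (f : ι → ABAlgebra) (n : ℕ) :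
    (∑ x ∈ s, f x).coeff n = ∑ x ∈ s, (f x).coeff n := by
  classical
  induction s using Finset.induction_on with
  | empty => simp
  | insert x s hx ih => rw [Finset.sum_insert hx, Finset.sum_insert hx, coeff_add, ih]

theorem coeff_sum_smul_a_pow_mul_b_pow (k : ℕ) (c : ℕ → ℂ) (n i : ℕ) :
    ((∑ j ∈ Finset.range (k + 1), c j • (a ^ j * b ^ (k - j))).coeff n).coeff i
      = if i + n = k then c i else 0 := by
  rw [coeff_sum, Polynomial.finsetSum_coeff]
  simp only [a_pow_eq_ofPoly, coeff_smul, coeff_ofPoly_mul_b_pow, Polynomial.coeff_smul]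
  split_ifs with h
  · rw [Finset.sum_eq_single i]
    · rw [if_pos (by omega)]
      simp
    · intro j _ hj
      split_ifs
      · simp [Polynomial.coeff_X_pow, hj.symm]
      · simp
    · intro hi
      rw [Finset.mem_range] at hi
      omega
  · refine Finset.sum_eq_zero fun j hj => ?_
    rw [Finset.mem_range] at hj
    split_ifs with hn
    · rw [Polynomial.coeff_X_pow, if_neg (by omega), smul_zero]
    · simp

theorem isMonicHomogeneous_iff {k : ℕ} {P : ABAlgebra} :
    IsMonicHomogeneous k P ↔ IsHomogeneous k P ∧ (P.coeff 0).coeff k = 1 := by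
  constructor
  · rintro ⟨c, hc, rfl⟩
    refine ⟨fun n i h => ?_, ?_⟩
    · rw [coeff_sum_smul_a_pow_mul_b_pow] at h
      by_contra h'
      exact h (if_neg h')
    · rw [coeff_sum_smul_a_pow_mul_b_pow, if_pos (add_zero k), hc]
  · rintro ⟨h, h1⟩
    refine ⟨fun j => (P.coeff (k - j)).coeff j, by simpa using h1, ?_⟩
    ext1 n
    ext i
    rw [coeff_sum_smul_a_pow_mul_b_pow]
    split_ifs with hi
    · rw [show k - i = n by omega]
    · by_contra h0
      exact hi (h n i h0)

theorem isMonicHomogeneous_linearProduct {k : ℕ} (l : Fin k → ℂ) :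
    IsMonicHomogeneous k (linearProduct l) :=
  isMonicHomogeneous_iff.mpr
    ⟨isHomogeneous_linearProduct l, by rw [coeff_zero_linearProduct]; simp⟩

/-! ### Power series in `b` -/

theorem coeff_ofPowerSeries (S : PowerSeries ℂ) (n : ℕ) :
    (ofPowerSeries S).coeff n = Polynomial.C (PowerSeries.coeff n S) := rfl

theorem coeff_mul_ofPowerSeries (P : ABAlgebra) (S : PowerSeries ℂ) (n : ℕ) :
    (P * ofPowerSeries S).coeff n
      = ∑ x ∈ Finset.HasAntidiagonal.antidiagonal n,
          P.coeff x.1 * Polynomial.C (PowerSeries.coeff x.2 S) := by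
  have h : ∀ m r : ℕ, bPowMulCoeff m (ofPowerSeries S) r
      = Polynomial.C (PowerSeries.coeff r S) := by
    intro m r
    unfold bPowMulCoeff
    cases r with
    | zero => simp [negBinom, coeff_ofPowerSeries]
    | succ r =>
      rw [Finset.Nat.sum_antidiagonal_succ']
      simp [negBinom, coeff_ofPowerSeries]
  simp only [coeff_mul, h]

theorem coeff_b_mul_succ (Q : ABAlgebra) (n : ℕ) :
    (b * Q).coeff (n + 1) = bPowMulCoeff 1 Q n := by
  rw [coeff_mul, Finset.sum_eq_single (1, n)]
  · simp [coeff_b]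
  · rintro ⟨x, y⟩ hx hne
    rw [Finset.HasAntidiagonal.mem_antidiagonal] at hx
    rw [coeff_b, if_neg, zero_mul]
    rintro rfl
    exact hne (Prod.ext rfl (by simp only at hx ⊢; omega))
  · intro h
    exact absurd (Finset.HasAntidiagonal.mem_antidiagonal.mpr (add_comm 1 n)) h

/-- Because `binom(-1, j) = (-1)^j`, the alternating sum of derivatives telescopes. Solving for
`Q.coeff (n + 1)` yields left division by `b`. -/
theorem bPowMulCoeff_one_left_succ (Q : ABAlgebra) (n : ℕ) :
    bPowMulCoeff 1 Q (n + 1)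
      = Q.coeff (n + 1) - Polynomial.derivative (bPowMulCoeff 1 Q n) := by
  unfold bPowMulCoeff
  rw [Finset.Nat.sum_antidiagonal_succ', map_sum, sub_eq_add_neg, ← Finset.sum_neg_distrib]
  congr 1
  · simp [negBinom]
  · refine Finset.sum_congr rfl fun y _ => ?_
    have h : negBinom 1 (y.2 + 1) = -negBinom 1 y.2 := by simp [negBinom, pow_succ]
    rw [h, neg_smul, map_zsmul, Function.iterate_succ_apply']

/-- An element is left divisible by `b` when its constant term in `b` vanishes. -/
theorem exists_eq_b_mul {X : ABAlgebra} {k : ℕ} {d : ℤ} (h0 : X.coeff 0 = 0)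
    (hk : DegreeLT k X) (hd : ValuationGE d X) :
    ∃ R : ABAlgebra, X = b * R ∧ R.coeff 0 = X.coeff 1 ∧ DegreeLT k R ∧
      ValuationGE (d - 1) R := by
  -- The quotient comes from `f(a) b^(n+1) = b (f(a) b^n + f'(a) b^(n+1))`.
  refine ⟨mk fun n => X.coeff (n + 1) + Polynomial.derivative (X.coeff n), ?_, ?_, fun ν => ?_,
    fun ν i h => ?_⟩
  · ext1 n
    cases n with
    | zero => rw [h0, coeff_zero_mul, coeff_b, if_neg zero_ne_one, zero_mul]
    | succ n =>
      rw [coeff_b_mul_succ]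
      induction n with
      | zero => simp [bPowMulCoeff, negBinom, h0]
      | succ n ih => rw [bPowMulCoeff_one_left_succ, ← ih, coeff_mk, add_sub_cancel_right]
  · rw [coeff_mk, h0, Polynomial.derivative_zero, add_zero]
  · exact (Polynomial.degree_add_le _ _).trans_lt
      (max_lt (hk _) ((Polynomial.degree_derivative_le).trans_lt (hk _)))
  · by_cases h1 : (X.coeff (ν + 1)).coeff i = 0
    · rw [coeff_mk, Polynomial.coeff_add, h1, zero_add, Polynomial.coeff_derivative] at h
      have := hd ν (i + 1) (left_ne_zero_of_mul h)
      push_cast at this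
      omega
    · have := hd (ν + 1) i h1
      push_cast at this
      omega

/-- Division with remainder by `a - λ b`. -/
theorem exists_eq_mul_add_ofPowerSeries (c : ℂ) (u : ABAlgebra) :
    ∃ (q : ABAlgebra) (S : PowerSeries ℂ), u = q * (a - c • b) + ofPowerSeries S := by
  -- The `b^(n+1)` coefficient of `q (a - cb)` is `X q_{n+1} - (n + c) q_n`. So `q_{n+1}` must be
  -- the quotient by `X` of `u_{n+1} + (n + c) q_n`, and the constant left over goes into `S`.
  let q : ℕ → Polynomial ℂ := fun n => Nat.rec (u.coeff 0).divX
    (fun n p => (u.coeff (n + 1) + ((n : ℂ) + c) • p).divX) n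
  have hq0 : q 0 = (u.coeff 0).divX := rfl
  have hq : ∀ n, q (n + 1) = (u.coeff (n + 1) + ((n : ℂ) + c) • q n).divX := fun _ => rfl
  refine ⟨mk q, PowerSeries.mk fun n => Nat.casesOn n ((u.coeff 0).coeff 0)
    fun n => (u.coeff (n + 1) + ((n : ℂ) + c) • q n).coeff 0, ?_⟩
  ext1 n
  rw [mul_sub, mul_smul_comm, mul_a, mul_b, coeff_add, coeff_sub, coeff_smul,
    coeff_ofPowerSeries, PowerSeries.coeff_mk]
  cases n with
  | zero =>
    rw [coeff_shiftA_zero, coeff_shiftB_zero, coeff_mk, hq0, smul_zero, sub_zero]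
    exact (Polynomial.X_mul_divX_add _).symm
  | succ n =>
    rw [coeff_shiftA_succ, coeff_shiftB_succ, coeff_mk, coeff_mk, hq n]
    have := Polynomial.X_mul_divX_add (u.coeff (n + 1) + ((n : ℂ) + c) • q n)
    have h2 : ((n : ℤ) • q n : Polynomial ℂ) = (n : ℂ) • q n := by
      rw [natCast_zsmul, Nat.cast_smul_eq_nsmul]
    rw [h2]
    linear_combination -this - add_smul (n : ℂ) c (q n)

/-- Inductively, `X q_n` is a constant, hence zero. Thus `ℂ[[b]]` embeds in `E_c`, and no power of
`b` dies there. -/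
theorem eq_zero_of_mul_eq_ofPowerSeries {c : ℂ} {q : ABAlgebra} {S : PowerSeries ℂ}
    (h : q * (a - c • b) = ofPowerSeries S) : q = 0 := by
  have key : ∀ (p : Polynomial ℂ) (z : ℂ), Polynomial.X * p = Polynomial.C z → p = 0 := by
    intro p z hp
    ext i
    have := congrArg (fun f => Polynomial.coeff f (i + 1)) hp
    simpa [Polynomial.coeff_C] using this
  have hn := fun n => congrArg (fun f => coeff f n) h
  simp only [mul_sub, mul_smul_comm, mul_a, mul_b, coeff_sub, coeff_smul,
    coeff_ofPowerSeries] at hn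
  ext1 n
  induction n with
  | zero =>
    have h0 := hn 0
    rw [coeff_shiftA_zero, coeff_shiftB_zero, smul_zero, sub_zero] at h0
    exact key _ _ h0
  | succ n ih =>
    have h1 := hn (n + 1)
    rw [coeff_shiftA_succ, coeff_shiftB_succ, ih, coeff_zero, smul_zero, smul_zero, sub_zero,
      sub_zero] at h1
    exact key _ _ h1

/-! ### The twisted action -/

theorem mem_leftIdeal {x u : ABAlgebra} : u ∈ leftIdeal x ↔ ∃ q, q * x = u :=
  Submodule.mem_span_singleton

theorem b_pow_eq_ofPowerSeries (n : ℕ) : b ^ n = ofPowerSeries (PowerSeries.X ^ n) := by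
  rw [map_pow]
  congr 1
  ext1 n
  rw [coeff_ofPowerSeries, PowerSeries.coeff_X, coeff_b]
  split_ifs <;> simp

/-- The commutator with `a` acts on powers of `b` as the derivation `b² d/db`. -/
theorem a_mul_b_pow (n : ℕ) : a * b ^ n = b ^ n * a + (n : ℂ) • b ^ (n + 1) := by
  induction n with
  | zero => simp
  | succ n ih =>
    have h : a * b = b * a + b ^ 2 := sub_eq_iff_eq_add'.mp a_mul_b_sub_b_mul_a
    rw [pow_succ, ← mul_assoc, ih, add_mul, mul_assoc, h, mul_add, smul_mul_assoc, ← pow_add,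
      ← pow_succ, mul_assoc, add_assoc]
    congr 1
    push_cast
    rw [add_smul, one_smul, add_comm]

theorem a_sub_smul_b_mul_b_pow_sub_mem (c z : ℂ) (n : ℕ) :
    (a - c • b) * b ^ n - (z + n - c) • b ^ (n + 1) ∈ leftIdeal (a - z • b) := by
  refine mem_leftIdeal.mpr ⟨b ^ n, ?_⟩
  rw [sub_mul, a_mul_b_pow, smul_mul_assoc, ← pow_succ', mul_sub, mul_smul_comm, ← pow_succ,
    sub_smul, add_smul]
  abel

/-- In `E_z` one has `a b^n = (z + n) b^(n+1)`. The factors act from right to left, so factor `j`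
(counted from 0) meets `b^(k-1-j)` and contributes `z + k - 1 - j - l j`. This is the source of the
shift in the twisted action. -/
theorem linearProduct_sub_mem {k : ℕ} (l : Fin k → ℂ) (z : ℂ) :
    linearProduct l - (∏ j, (z + k - 1 - (l j + (j : ℕ)))) • b ^ k
      ∈ leftIdeal (a - z • b) := by
  induction k with
  | zero => simp [linearProduct_zero]
  | succ k ih =>
    have h1 := (leftIdeal (a - z • b)).smul_mem (a - l 0 • b) (ih fun j => l j.succ)
    set p := ∏ j : Fin k, (z + k - 1 - (l j.succ + (j : ℕ))) with hp
    have h2 := (leftIdeal (a - z • b)).smul_mem (algebraMap ℂ ABAlgebra p)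
      (a_sub_smul_b_mul_b_pow_sub_mem (l 0) z k)
    have h3 := add_mem h1 h2
    rw [linearProduct_succ, Fin.prod_univ_succ]
    have h4 : ∏ j : Fin k, (z + ((k + 1 : ℕ) : ℂ) - 1 - (l j.succ + ((j.succ : Fin (k + 1)) : ℕ)))
        = p := by
      refine Finset.prod_congr rfl fun j _ => ?_
      rw [Fin.val_succ]
      push_cast
      ring
    rw [h4]
    convert h3 using 1
    rw [algebraMap_smul, smul_eq_mul, mul_sub, mul_smul_comm, smul_sub, smul_smul,
      sub_add_sub_cancel]
    congr 2
    rw [mul_comm]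
    push_cast
    rw [Fin.val_zero]
    push_cast
    ring

theorem exists_perm_of_map_univ_eq {ι α : Type*} [Fintype ι] {f g : ι → α}
    (h : Multiset.map f Finset.univ.val = Multiset.map g Finset.univ.val) :
    ∃ σ : Equiv.Perm ι, ∀ j, g (σ j) = f j := by
  classical
  have hcard : ∀ x, Fintype.card {j // f j = x} = Fintype.card {j // g j = x} := by
    intro x
    have h1 := congrArg (Multiset.count x) h
    rw [Multiset.count_map, Multiset.count_map] at h1
    rw [Fintype.card_subtype, Fintype.card_subtype]
    simp only [eq_comm (b := x)]
    exact h1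
  exact ⟨Equiv.ofFiberEquiv fun x => Fintype.equivOfCardEq (hcard x),
    fun j => Equiv.ofFiberEquiv_map _ j⟩

theorem mem_twistedOrbit_of_linearProduct_eq {k : ℕ} {l m : Fin k → ℂ}
    (h : linearProduct l = linearProduct m) : m ∈ twistedOrbit l := by
  have key : ∀ z : ℂ, ∏ j, (z + k - 1 - (l j + (j : ℕ))) = ∏ j, (z + k - 1 - (m j + (j : ℕ))) := by
    intro z
    -- The difference of the two reductions is a scalar times `b^k` that vanishes in `E_z`, so the
    -- scalar is zero.
    have h1 := sub_mem (linearProduct_sub_mem l z) (linearProduct_sub_mem m z)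
    rw [h, sub_sub_sub_cancel_left, ← sub_smul, b_pow_eq_ofPowerSeries] at h1
    obtain ⟨q, hq⟩ := mem_leftIdeal.mp h1
    have h2 : ∀ (c : ℂ) (S : PowerSeries ℂ), c • ofPowerSeries S = ofPowerSeries (c • S) := by
      intro c S
      ext1 n
      rw [coeff_smul, coeff_ofPowerSeries, coeff_ofPowerSeries]
      simp [Polynomial.smul_C]
    have hq0 := eq_zero_of_mul_eq_ofPowerSeries (hq.trans (h2 _ _))
    rw [hq0, zero_mul, ← b_pow_eq_ofPowerSeries] at hq
    have h3 := congrArg (fun f => (coeff f k)) hq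
    rw [coeff_smul, b_pow_eq_ofPowerSeries, coeff_ofPowerSeries] at h3
    simp only [coeff_zero, PowerSeries.coeff_X_pow_self, map_one] at h3
    rcases smul_eq_zero.mp h3.symm with h4 | h4
    · exact (sub_eq_zero.mp h4).symm
    · exact absurd h4 one_ne_zero
  have hpoly : ∏ j, (Polynomial.X - Polynomial.C (l j + (j : ℕ)))
      = ∏ j, (Polynomial.X - Polynomial.C (m j + (j : ℕ))) := by
    refine Polynomial.funext fun x => ?_
    rw [Polynomial.eval_prod, Polynomial.eval_prod]
    have h1 := key (x - k + 1)
    rw [show x - k + 1 + k - 1 = x by ring] at h1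
    simpa using h1
  have hroots := congrArg Polynomial.roots hpoly
  rw [Polynomial.roots_prod _ _ (Finset.prod_ne_zero_iff.mpr fun j _ => Polynomial.X_sub_C_ne_zero _),
    Polynomial.roots_prod _ _ (Finset.prod_ne_zero_iff.mpr fun j _ => Polynomial.X_sub_C_ne_zero _)]
    at hroots
  simp only [Polynomial.roots_X_sub_C, Multiset.bind_singleton] at hroots
  obtain ⟨σ, hσ⟩ := exists_perm_of_map_univ_eq hroots.symm
  refine ⟨σ, funext fun j => ?_⟩
  change l (σ j) + ((σ j : ℕ) : ℂ) - ((j : ℕ) : ℂ) = m j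
  rw [hσ, add_sub_cancel_right]

/-! ### Annihilators of generators -/

/-- `P` is of degree at most `k` in `a`, and its initial form is a nonzero multiple of `L`, of
degree `k`. -/
def HasInitialForm (k : ℕ) (L P : ABAlgebra) : Prop :=
  (∀ ν, (P.coeff ν).degree ≤ (k : WithBot ℕ)) ∧ ∃ c : ℂ, c ≠ 0 ∧ ValuationGE (k + 1) (P - c • L)

theorem degree_coeff_mul_ofPowerSeries_le {k : ℕ} {P : ABAlgebra} (S : PowerSeries ℂ)
    (h : ∀ ν, (P.coeff ν).degree ≤ (k : WithBot ℕ)) (ν : ℕ) :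
    ((P * ofPowerSeries S).coeff ν).degree ≤ (k : WithBot ℕ) := by
  rw [coeff_mul_ofPowerSeries]
  refine (Polynomial.degree_sum_le _ _).trans (Finset.sup_le fun x _ => ?_)
  refine (Polynomial.degree_mul_le _ _).trans ?_
  calc _ ≤ (k : WithBot ℕ) + 0 := add_le_add (h _) Polynomial.degree_C_le
    _ = k := add_zero _

theorem ValuationGE.ofPowerSeries_sub_constantCoeff (S : PowerSeries ℂ) :
    ValuationGE 1 (ofPowerSeries S - PowerSeries.constantCoeff S • (1 : ABAlgebra)) := by
  intro n i h
  cases n with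
  | zero =>
    rw [coeff_sub, coeff_smul, coeff_one, coeff_ofPowerSeries] at h
    simp [Polynomial.smul_eq_C_mul] at h
  | succ n => push_cast; omega

theorem valuationGE_sub_constantCoeff (u : ABAlgebra) :
    ValuationGE 1 (u - (u.coeff 0).coeff 0 • (1 : ABAlgebra)) := by
  intro n i h
  cases n with
  | zero =>
    cases i with
    | zero =>
      rw [coeff_sub, coeff_smul, coeff_one] at h
      simp at h
    | succ i => push_cast; omega
  | succ n => push_cast; omega

/-- Modulo valuation 1, `S` is its constant term, so the initial form is only rescaled. -/
theorem HasInitialForm.mul_ofPowerSeries {k : ℕ} {L P : ABAlgebra} (hL : IsHomogeneous k L)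
    (hP : HasInitialForm k L P) {S : PowerSeries ℂ} (hS : PowerSeries.constantCoeff S ≠ 0) :
    HasInitialForm k L (P * ofPowerSeries S) := by
  obtain ⟨hd, c, hc, hv⟩ := hP
  refine ⟨degree_coeff_mul_ofPowerSeries_le S hd, c * PowerSeries.constantCoeff S,
    mul_ne_zero hc hS, ?_⟩
  have h1 := hv.mul (valuationGE_zero (ofPowerSeries S))
  have h2 := (hL.valuationGE.smul c).mul (ValuationGE.ofPowerSeries_sub_constantCoeff S)
  rw [add_zero] at h1
  convert h1.add h2 using 1
  rw [sub_mul, mul_sub, mul_smul_comm _ (c • L), mul_one, smul_smul, mul_comm c]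
  abel

theorem HasInitialForm.mul_a_sub_smul_b {k : ℕ} {L P : ABAlgebra} (hP : HasInitialForm k L P)
    (z : ℂ) : HasInitialForm (k + 1) (L * (a - z • b)) (P * (a - z • b)) := by
  obtain ⟨hd, c, hc, hv⟩ := hP
  refine ⟨fun ν => ?_, c, hc, ?_⟩
  · have hX : ∀ n, (Polynomial.X * P.coeff n).degree ≤ ((k + 1 : ℕ) : WithBot ℕ) := by
      intro n
      rw [Polynomial.degree_mul, Polynomial.degree_X, add_comm]
      push_cast
      exact add_le_add_left (hd n) 1
    have hk : ∀ n, (P.coeff n).degree ≤ ((k + 1 : ℕ) : WithBot ℕ) := fun n =>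
      (hd n).trans (by exact_mod_cast Nat.le_succ k)
    rw [mul_sub, mul_smul_comm, mul_a, mul_b, coeff_sub, coeff_smul]
    cases ν with
    | zero =>
      rw [coeff_shiftA_zero, coeff_shiftB_zero, smul_zero, sub_zero]
      exact hX 0
    | succ ν =>
      rw [coeff_shiftA_succ, coeff_shiftB_succ]
      refine (Polynomial.degree_sub_le _ _).trans (max_le ((Polynomial.degree_sub_le _ _).trans
        (max_le (hX _) ((Polynomial.degree_smul_le _ _).trans (hk _))))
        ((Polynomial.degree_smul_le _ _).trans (hk _)))
  · have := hv.mul (isHomogeneous_a_sub_smul_b z).valuationGE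
    rw [← smul_mul_assoc, ← sub_mul]
    exact_mod_cast this

/-- An element with initial form `L`, monic homogeneous, can be normalized by a unit of
`ℂ[[b]]`. -/
theorem HasInitialForm.exists_mul_eq {k : ℕ} {L P : ABAlgebra} (hL : IsMonicHomogeneous k L)
    (hP : HasInitialForm k L P) :
    ∃ S T R : ABAlgebra, S * T = 1 ∧ T * S = 1 ∧ DegreeLT k R ∧ ValuationGE ((k : ℤ) - 1) R ∧
      P * S = L + b ^ 2 * R := by
  rw [isMonicHomogeneous_iff] at hL
  obtain ⟨hL, hL1⟩ := hL
  -- `T` is the coefficient of `a^k` in `P`, with powers of `b` on the right; multiplying by `T⁻¹`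
  -- on the right makes `P` monic in `a`.
  let T : PowerSeries ℂ := PowerSeries.mk fun ν => (P.coeff ν).coeff k
  have hlead : ∀ (X : ABAlgebra) (c : ℂ), ValuationGE (k + 1) (X - c • L) →
      (X.coeff 0).coeff k = c := by
    intro X c h
    by_contra hne
    have := h 0 k (by
      rw [coeff_sub, Polynomial.coeff_sub, coeff_smul, Polynomial.coeff_smul, hL1, smul_eq_mul,
        mul_one]
      exact sub_ne_zero.mpr hne)
    omega
  have hT : PowerSeries.constantCoeff T ≠ 0 := by
    obtain ⟨-, c, hc, hv⟩ := hP
    rw [← PowerSeries.coeff_zero_eq_constantCoeff_apply, PowerSeries.coeff_mk, hlead P c hv]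
    exact hc
  have hT' : PowerSeries.constantCoeff T⁻¹ ≠ 0 := by
    rw [PowerSeries.constantCoeff_inv]
    exact inv_ne_zero hT
  have htop : ∀ ν, ((P * ofPowerSeries T⁻¹).coeff ν).coeff k = if ν = 0 then 1 else 0 := by
    intro ν
    rw [← PowerSeries.coeff_one, ← PowerSeries.mul_inv_cancel T hT, PowerSeries.coeff_mul,
      coeff_mul_ofPowerSeries, Polynomial.finsetSum_coeff]
    refine Finset.sum_congr rfl fun x _ => ?_
    rw [Polynomial.coeff_mul_C, PowerSeries.coeff_mk]
  obtain ⟨hd, c, -, hv⟩ := hP.mul_ofPowerSeries hL hT'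
  obtain rfl : 1 = c := by rw [← hlead _ c hv, htop, if_pos rfl]
  rw [one_smul] at hv
  have hdeg : DegreeLT k (P * ofPowerSeries T⁻¹ - L) := by
    intro ν
    rw [Polynomial.degree_lt_iff_coeff_zero]
    intro i hi
    rw [coeff_sub, Polynomial.coeff_sub]
    rcases hi.eq_or_lt with rfl | hi
    · rw [htop]
      split_ifs with hν
      · rw [hν, hL1, sub_self]
      · by_contra h
        have := hL ν k fun h0 => h (by rw [h0, sub_self])
        omega
    · rw [Polynomial.coeff_eq_zero_of_degree_lt ((hd ν).trans_lt (by exact_mod_cast hi)),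
        zero_sub, neg_eq_zero]
      by_contra h
      have := hL ν i h
      omega
  -- Degree in `a` below `k` and total degree at least `k + 1` force the exponent of `b` to be at
  -- least 2.
  have hlow : ∀ ν, ν < 2 → (P * ofPowerSeries T⁻¹ - L).coeff ν = 0 := by
    intro ν hν
    ext i
    rw [Polynomial.coeff_zero]
    by_contra h
    have h1 := hv ν i h
    have h2 := Polynomial.degree_lt_iff_coeff_zero _ _ |>.mp (hdeg ν) i
    exact h (h2 (by omega))
  obtain ⟨R₁, hR₁, hR₁0, hR₁d, hR₁v⟩ := exists_eq_b_mul (hlow 0 two_pos) hdeg hv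
  obtain ⟨R, hR, -, hRd, hRv⟩ := exists_eq_b_mul (hR₁0.trans (hlow 1 one_lt_two)) hR₁d hR₁v
  refine ⟨ofPowerSeries T⁻¹, ofPowerSeries T, R, ?_, ?_, hRd, ?_, ?_⟩
  · rw [← map_mul, PowerSeries.inv_mul_cancel _ hT, map_one]
  · rw [← map_mul, PowerSeries.mul_inv_cancel _ hT, map_one]
  · rwa [show (k : ℤ) + 1 - 1 - 1 = k - 1 by ring] at hRv
  · rw [pow_two, mul_assoc, ← hR, ← hR₁, add_sub_cancel]

/-! ### Generators, annihilators and Bernstein elements -/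

section Modules

variable {E : Type*} [AddCommGroup E] [Module ABAlgebra E]

theorem exists_linearEquiv_of_annihilator {e : E} {P : ABAlgebra}
    (hgen : Submodule.span ABAlgebra {e} = ⊤) (hann : ∀ u : ABAlgebra, u • e = 0 ↔ u ∈ leftIdeal P) :
    Nonempty (E ≃ₗ[ABAlgebra] (ABAlgebra ⧸ leftIdeal P)) := by
  have hs : Function.Surjective (LinearMap.toSpanSingleton ABAlgebra E e) := by
    rw [← LinearMap.range_eq_top, LinearMap.range_toSpanSingleton, hgen]
  have hk : LinearMap.ker (LinearMap.toSpanSingleton ABAlgebra E e) = leftIdeal P := by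
    ext u
    rw [LinearMap.mem_ker, LinearMap.toSpanSingleton_apply, hann]
  exact ⟨((Submodule.quotEquivOfEq _ _ hk).symm.trans
    (LinearMap.quotKerEquivOfSurjective _ hs)).symm⟩

theorem exists_generator_of_linearEquiv {I : Submodule ABAlgebra ABAlgebra}
    (φ : E ≃ₗ[ABAlgebra] (ABAlgebra ⧸ I)) :
    ∃ e : E, Submodule.span ABAlgebra {e} = ⊤ ∧ ∀ u : ABAlgebra, u • e = 0 ↔ u ∈ I := by
  have h : ∀ u : ABAlgebra, u • φ.symm (I.mkQ 1) = φ.symm (I.mkQ u) := fun u => by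
    rw [← map_smul, ← map_smul, smul_eq_mul, mul_one]
  refine ⟨φ.symm (I.mkQ 1), ?_, fun u => ?_⟩
  · rw [eq_top_iff]
    intro x _
    obtain ⟨u, hu⟩ := I.mkQ_surjective (φ x)
    exact Submodule.mem_span_singleton.mpr ⟨u, by rw [h, hu, φ.symm_apply_apply]⟩
  · rw [h, LinearEquiv.map_eq_zero_iff, Submodule.mkQ_apply, Submodule.Quotient.mk_eq_zero]

/-- If `M / N ≃ E_λ` and `e` generates `M`, then up to a unit of `ℂ[[b]]` the image of `e` is the
canonical generator of `E_λ`. -/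
theorem exists_unit_smul_mem_iff {N M : Submodule ABAlgebra E} {c : ℂ}
    (φ : (M ⧸ N.submoduleOf M) ≃ₗ[ABAlgebra] ELambda c) {e : E}
    (he : Submodule.span ABAlgebra {e} = M) :
    ∃ S : PowerSeries ℂ, PowerSeries.constantCoeff S ≠ 0 ∧
      ∀ u : ABAlgebra, u • ofPowerSeries S • e ∈ N ↔ u ∈ leftIdeal (a - c • b) := by
  have heM : e ∈ M := he ▸ Submodule.mem_span_singleton_self e
  let ψ : M →ₗ[ABAlgebra] ELambda c := φ.toLinearMap ∘ₗ (N.submoduleOf M).mkQ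
  have hψ : ∀ x : M, ψ x = 0 ↔ (x : E) ∈ N := by
    intro x
    change φ ((N.submoduleOf M).mkQ x) = 0 ↔ _
    rw [LinearEquiv.map_eq_zero_iff, Submodule.mkQ_apply, Submodule.Quotient.mk_eq_zero,
      Submodule.submoduleOf, Submodule.mem_comap, Submodule.subtype_apply]
  have hψs : Function.Surjective ψ := φ.surjective.comp (Submodule.mkQ_surjective _)
  let I := leftIdeal (a - c • b)
  have hI : ∀ u v : ABAlgebra, u • I.mkQ v = I.mkQ (u * v) := fun u v => by
    rw [← map_smul, smul_eq_mul]
  obtain ⟨u, hu⟩ := I.mkQ_surjective (ψ ⟨e, heM⟩)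
  obtain ⟨q, T, hT⟩ := exists_eq_mul_add_ofPowerSeries c u
  have hT' : ψ ⟨e, heM⟩ = I.mkQ (ofPowerSeries T) := by
    rw [← hu, ← sub_eq_zero, ← map_sub, Submodule.mkQ_apply, Submodule.Quotient.mk_eq_zero]
    exact mem_leftIdeal.mpr ⟨q, by rw [hT, add_sub_cancel_right]⟩
  -- As `e` generates `M`, some `v` has `vT - 1` in the left ideal of `a - cb`, where constant terms
  -- vanish.
  have hT0 : PowerSeries.constantCoeff T ≠ 0 := by
    obtain ⟨⟨x, hx⟩, hx1⟩ := hψs (I.mkQ 1)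
    obtain ⟨v, hv⟩ := Submodule.mem_span_singleton.mp (he ▸ hx : x ∈ Submodule.span ABAlgebra {e})
    have h1 : (⟨x, hx⟩ : M) = v • ⟨e, heM⟩ := Subtype.ext hv.symm
    rw [h1, map_smul, hT', hI, ← sub_eq_zero, ← map_sub, Submodule.mkQ_apply,
      Submodule.Quotient.mk_eq_zero] at hx1
    obtain ⟨w, hw⟩ := mem_leftIdeal.mp hx1
    have h2 := congrArg (fun f => (coeff f 0).coeff 0) hw
    rw [coeff_zero_mul, coeff_zero_a_sub_smul_b, coeff_sub, coeff_zero_mul] at h2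
    intro h0
    simp [coeff_one, coeff_ofPowerSeries, h0] at h2
  refine ⟨T⁻¹, ?_, fun v => ?_⟩
  · rw [PowerSeries.constantCoeff_inv]
    exact inv_ne_zero hT0
  · rw [← smul_assoc, smul_eq_mul]
    have h1 := hψ ((v * ofPowerSeries T⁻¹) • ⟨e, heM⟩)
    rw [map_smul, hT', hI, mul_assoc, ← map_mul, PowerSeries.inv_mul_cancel _ hT0, map_one,
      mul_one, Submodule.mkQ_apply, Submodule.Quotient.mk_eq_zero] at h1
    exact h1.symm

/-- Induction on `j`, for an arbitrary generator of `F_j`, since each step changes the generator. -/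
theorem IsJordanHolder.exists_annihilator {k : ℕ} {F : Fin (k + 1) → Submodule ABAlgebra E}
    {l : Fin k → ℂ} (hF : IsJordanHolder F l) (j : ℕ) (hj : j ≤ k) (e : E)
    (he : Submodule.span ABAlgebra {e} = F ⟨j, by omega⟩) :
    ∃ P : ABAlgebra, HasInitialForm j (linearProduct fun i : Fin j => l (Fin.castLE hj i)) P ∧
      ∀ u : ABAlgebra, u • e = 0 ↔ u ∈ leftIdeal P := by
  induction j generalizing e with
  | zero =>
    have h0 : e = 0 := by
      have h1 : e ∈ Submodule.span ABAlgebra {e} := Submodule.mem_span_singleton_self e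
      rw [he] at h1
      have h2 : F ⟨0, by omega⟩ = ⊥ := hF.bot
      rwa [h2, Submodule.mem_bot] at h1
    refine ⟨1, ⟨fun ν => ?_, 1, one_ne_zero, ?_⟩, fun u => ?_⟩
    · rw [coeff_one]
      split_ifs <;> simp
    · rw [linearProduct_zero, one_smul, sub_self]
      intro n i h
      simp at h
    · rw [h0, smul_zero]
      exact ⟨fun _ => mem_leftIdeal.mpr ⟨u, mul_one u⟩, fun _ => rfl⟩
  | succ j ih =>
    let i : Fin k := ⟨j, hj⟩
    obtain ⟨φ⟩ := hF.quot i
    have hle : F i.castSucc ≤ F i.succ := hF.mono (Fin.castSucc_le_succ i)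
    obtain ⟨S, hS, hmem⟩ := exists_unit_smul_mem_iff φ (e := e) he
    have hSinv : ofPowerSeries S⁻¹ * ofPowerSeries S = 1 := by
      rw [← map_mul, PowerSeries.inv_mul_cancel _ hS, map_one]
    have hSinv' : ofPowerSeries S * ofPowerSeries S⁻¹ = 1 := by
      rw [← map_mul, PowerSeries.mul_inv_cancel _ hS, map_one]
    set e' : E := ofPowerSeries S • e with he'
    have hee' : e = ofPowerSeries S⁻¹ • e' := by
      rw [he', ← smul_assoc, smul_eq_mul, hSinv, one_smul]
    -- Elements of `F_j` are the `u e'` with `u` in the left ideal of `a - λb`, so `(a - λb) e'`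
    -- generates `F_j`.
    obtain ⟨P, hP, hann⟩ := ih (by omega) ((a - l i • b) • e') (by
      refine le_antisymm ?_ fun x hx => ?_
      · rw [Submodule.span_singleton_le_iff_mem]
        exact (hmem _).mpr (mem_leftIdeal.mpr ⟨1, one_mul _⟩)
      · have hx1 : x ∈ Submodule.span ABAlgebra {e} := he ▸ hle hx
        obtain ⟨v, hv⟩ := Submodule.mem_span_singleton.mp hx1
        rw [hee', ← smul_assoc, smul_eq_mul] at hv
        rw [← hv] at hx
        obtain ⟨q, hq⟩ := mem_leftIdeal.mp ((hmem _).mp hx)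
        refine Submodule.mem_span_singleton.mpr ⟨q, ?_⟩
        rw [← smul_assoc, smul_eq_mul, hq, hv])
    have hann' : ∀ u : ABAlgebra, u • e' = 0 ↔ u ∈ leftIdeal (P * (a - l i • b)) := by
      intro u
      rw [mem_leftIdeal]
      constructor
      · intro hu
        obtain ⟨q, hq⟩ := mem_leftIdeal.mp ((hmem u).mp (hu ▸ Submodule.zero_mem _))
        rw [← hq, ← smul_eq_mul, smul_assoc, hann] at hu
        obtain ⟨w, hw⟩ := mem_leftIdeal.mp hu
        exact ⟨w, by rw [← mul_assoc, hw, hq]⟩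
      · rintro ⟨w, rfl⟩
        rw [← mul_assoc, ← smul_eq_mul (w * P), smul_assoc, hann]
        exact mem_leftIdeal.mpr ⟨w, rfl⟩
    refine ⟨P * (a - l i • b) * ofPowerSeries S, ?_, fun u => ?_⟩
    · rw [linearProduct_succ_last]
      exact (hP.mul_a_sub_smul_b _).mul_ofPowerSeries
        ((isHomogeneous_linearProduct _).mul (isHomogeneous_a_sub_smul_b _)) hS
    · rw [hee', ← smul_assoc, smul_eq_mul, hann', mem_leftIdeal, mem_leftIdeal]
      refine exists_congr fun w => ⟨fun h => ?_, fun h => ?_⟩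
      · rw [← mul_assoc, h, mul_assoc, hSinv, mul_one]
      · rw [← h, mul_assoc, mul_assoc, hSinv', mul_one]

theorem IsJordanHolder.isBernsteinElement {k : ℕ} (hmono : IsMonogenic E) (hrank : rank E = k)
    {F : Fin (k + 1) → Submodule ABAlgebra E} {l : Fin k → ℂ} (hF : IsJordanHolder F l) :
    IsBernsteinElement E (linearProduct l) := by
  obtain ⟨I, ⟨φ⟩⟩ := hmono
  obtain ⟨e, he, -⟩ := exists_generator_of_linearEquiv φ
  obtain ⟨P, hP, hann⟩ := hF.exists_annihilator k le_rfl e (he.trans hF.top.symm)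
  obtain ⟨S, T, R, hST, hTS, hR, hRv, hPS⟩ := HasInitialForm.exists_mul_eq
    (isMonicHomogeneous_linearProduct _) hP
  rw [IsBernsteinElement, hrank]
  refine ⟨isMonicHomogeneous_linearProduct l, R, hR, hRv, ?_⟩
  -- Replacing `P` by `P S` amounts to replacing the generator `e` by `T e`.
  have heT : e = S • T • e := by rw [← smul_assoc, smul_eq_mul, hST, one_smul]
  refine exists_linearEquiv_of_annihilator (e := T • e) ?_ fun u => ?_
  · rw [eq_top_iff, ← he, Submodule.span_singleton_le_iff_mem]
    exact Submodule.mem_span_singleton.mpr ⟨S, heT.symm⟩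
  · rw [← smul_assoc, smul_eq_mul, hann, mem_leftIdeal, mem_leftIdeal]
    refine exists_congr fun w => ?_
    change w * P = u * T ↔ w * (linearProduct (fun i : Fin k => l i) + b ^ 2 * R) = u
    have hPS' : P * S = linearProduct (fun i : Fin k => l i) + b ^ 2 * R := hPS
    rw [← hPS']
    refine ⟨fun h => ?_, fun h => ?_⟩
    · rw [← mul_assoc, h, mul_assoc, hTS, mul_one]
    · rw [← h, mul_assoc, mul_assoc, hST, mul_one]

theorem IsBernsteinElement.unique {P Q : ABAlgebra} (hP : IsBernsteinElement E P)
    (hQ : IsBernsteinElement E Q) : P = Q := by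
  obtain ⟨hPm, R, -, hRv, ⟨φ⟩⟩ := hP
  obtain ⟨hQm, R', -, hRv', ⟨φ'⟩⟩ := hQ
  generalize hk : rank E = k at *
  rw [isMonicHomogeneous_iff] at hPm hQm
  obtain ⟨e, he, hann⟩ := exists_generator_of_linearEquiv φ
  obtain ⟨e', he', hann'⟩ := exists_generator_of_linearEquiv φ'
  obtain ⟨u, hu⟩ := Submodule.mem_span_singleton.mp (he ▸ Submodule.mem_top : e' ∈ _)
  obtain ⟨v, hv⟩ := Submodule.mem_span_singleton.mp (he' ▸ Submodule.mem_top : e ∈ _)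
  have hb : ValuationGE 2 (b ^ 2) := by
    rw [pow_two]
    exact isHomogeneous_b.valuationGE.mul isHomogeneous_b.valuationGE
  have hR2 : ValuationGE (k + 1) (b ^ 2 * R) := by
    have := hb.mul hRv
    rwa [show (2 : ℤ) + (k - 1) = k + 1 by ring] at this
  have hR2' : ValuationGE (k + 1) (b ^ 2 * R') := by
    have := hb.mul hRv'
    rwa [show (2 : ℤ) + (k - 1) = k + 1 by ring] at this
  have hP0 : ValuationGE k (P + b ^ 2 * R) :=
    hPm.1.valuationGE.add fun ν i h => (Int.le_add_one le_rfl).trans (hR2 ν i h)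
  -- `vu - 1` kills `e`, so it is a left multiple of an element of valuation at least `k > 0`; hence
  -- `vu` has constant term 1. For `k = 0` no such argument is available, but both elements are then
  -- scalars equal to 1.
  have hu0 : k ≠ 0 → (u.coeff 0).coeff 0 ≠ 0 := by
    intro hk0 hu0
    have h1 : (v * u - 1) • e = 0 := by
      rw [sub_smul, ← smul_eq_mul, smul_assoc, hu, hv, one_smul, sub_self]
    obtain ⟨q, hq⟩ := mem_leftIdeal.mp ((hann _).mp h1)
    have h2 := congrArg (fun f => (coeff f 0).coeff 0) hq
    have h3 : ((P + b ^ 2 * R).coeff 0).coeff 0 = 0 := by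
      by_contra h
      have := hP0 0 0 h
      omega
    rw [coeff_zero_mul, coeff_sub, coeff_zero_mul, Polynomial.mul_coeff_zero, h3,
      Polynomial.coeff_sub, Polynomial.mul_coeff_zero, hu0] at h2
    simp [coeff_one] at h2
  obtain ⟨z, hz⟩ : ∃ z : ℂ, ValuationGE (k + 1) (Q - z • P) := by
    rcases eq_or_ne k 0 with rfl | hk0
    · refine ⟨1, fun ν i h => ?_⟩
      have h1 := hQm.1.sub_smul 1 hPm.1 ν i h
      obtain ⟨rfl, rfl⟩ : i = 0 ∧ ν = 0 := by omega
      rw [one_smul, coeff_sub, Polynomial.coeff_sub, hPm.2, hQm.2, sub_self] at h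
      exact absurd rfl h
    · have h1 : ((Q + b ^ 2 * R') * u) • e = 0 := by
        rw [← smul_eq_mul, smul_assoc, hu, hann']
        exact mem_leftIdeal.mpr ⟨1, one_mul _⟩
      obtain ⟨w, hw⟩ := mem_leftIdeal.mp ((hann _).mp h1)
      set x := (u.coeff 0).coeff 0 with hx
      set y := (w.coeff 0).coeff 0 with hy
      -- Degree `k` part of `(Q + b²R') u = w (P + b²R)`: only the constant terms of `u` and `w`
      -- contribute.
      have h2 : ValuationGE (k + 1) (x • Q - y • P) := by
        have e1 := hQm.1.valuationGE.mul (valuationGE_sub_constantCoeff u)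
        have e2 := hR2'.mul (valuationGE_zero u)
        have e3 := (valuationGE_sub_constantCoeff w).mul hPm.1.valuationGE
        have e4 := (valuationGE_zero w).mul hR2
        rw [add_zero] at e2
        rw [add_comm] at e3
        rw [zero_add] at e4
        convert (e3.add e4).sub (e1.add e2) using 1
        have h3 : w * P + w * (b ^ 2 * R) = Q * u + b ^ 2 * R' * u := by
          rw [← mul_add, hw, add_mul]
        rw [sub_mul, mul_sub, smul_mul_assoc, one_mul, mul_smul_comm, mul_one, ← hx, ← hy,
          eq_sub_of_add_eq h3]
        abel
      refine ⟨x⁻¹ * y, ?_⟩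
      have h3 := h2.smul x⁻¹
      rwa [smul_sub, smul_smul, smul_smul, inv_mul_cancel₀ (hu0 hk0), one_smul] at h3
  have h1 := (hQm.1.sub_smul z hPm.1).eq_zero hz
  have h2 := congrArg (fun f => (coeff f 0).coeff k) h1
  simp only [coeff_sub, coeff_smul, Polynomial.coeff_sub, Polynomial.coeff_smul, hPm.2, hQm.2,
    coeff_zero, Polynomial.coeff_zero, smul_eq_mul, mul_one] at h2
  rw [← sub_eq_zero.mp h2, one_smul] at h1
  exact (sub_eq_zero.mp h1).symm

end Modules

end ABAlgebra

open ABAlgebra in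
theorem mainTheorem6 {E : Type*} [AddCommGroup E] [Module ABAlgebra E] {k : ℕ}
    (hmono : IsMonogenic E) (hreg : IsRegular E) (hrank : ABAlgebra.rank E = k)
    (F : Fin (k + 1) → Submodule ABAlgebra E) (l : Fin k → ℂ) (hF : IsJordanHolder F l) :
    (∀ P : ABAlgebra, IsBernsteinElement E P ↔ P = linearProduct l) ∧
      ∀ (F' : Fin (k + 1) → Submodule ABAlgebra E) (m : Fin k → ℂ), IsJordanHolder F' m →
        m ∈ twistedOrbit l := by
  have hB := hF.isBernsteinElement hmono hrank
  refine ⟨fun P => ⟨fun hP => hP.unique hB, fun hP => hP ▸ hB⟩, fun F' m hF' => ?_⟩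
  exact mem_twistedOrbit_of_linearProduct_eq (hB.unique (hF'.isBernsteinElement hmono hrank))
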